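/- Let $p$ be an odd prime, let $s,h,t,r$ be positive integers with $t\mid h$, $s\le h$ and $\gcd(r,p)=1$, and put $q=p^h$, $n=2rp^s$ and $k=rp^s-1$. Let $b,c\in\mathbb{F}_{p^t}$ be nonzero and suppose that $\mathbb{F}_q$ is the splitting field over $\mathbb{F}_{p^t}$ of $$g(x)=x^{2rp^s}+b\,x^{2rp^s-1}+c .$$ Let $\alpha_1,\dots,\alpha_n\in\mathbb{F}_q$ be all the roots of $g$, and let $v_i=\alpha_i^{1-rp^s}$ for $1\le i\le n$. Let $\eta_{12},\eta_{22}\in\mathbb{F}_q^*$ and $\eta_{i1}=\frac{b}{2}\eta_{i2}$ for $i=1,2$. Set $$\mathcal{S}_1=\Big\{\sum_{i=0}^{rp^s-2}f_ix^i+\sum_{i=1}^{2}f_{rp^s-4+i}\,\eta_{i2}\Big(\tfrac{b}{2}x^{rp^s-1}+x^{rp^s}\Big)\ :\ f_i\in\mathbb{F}_q \text{ for } 0\le i\le rp^s-2\Big\}$$ and $$\mathcal{C}_1=\{(v_1f(\alpha_1),\dots,v_nf(\alpha_n)) : f\in\mathcal{S}_1\}\subseteq\mathbb{F}_q^n .$$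 Then $\mathcal{C}_1$ is a linear code over $\mathbb{F}_q$ of length $2rp^s$, dimension $rp^s-1$ and minimum distance at least $rp^s$. It is self-orthogonal: $\sum_{i=1}^n x_iy_i=0$ for all $x,y\in\mathcal{C}_1$. Moreover it is a twisted generalized Reed--Solomon (TGRS) code: $\alpha_1,\dots,\alpha_n$ are pairwise distinct, all $v_i$ are nonzero, and $\mathcal{C}_1$ is the set of vectors $(v_1f(\alpha_1),\dots,v_nf(\alpha_n))$ where $f$ runs over the polynomials $$\sum_{i=0}^{k-1}f_ix^i+\sum_{i=0}^{k-1}f_i\sum_{j=1}^{n-k}a_{i+1,j}\,x^{k-1+j},\qquad f_0,\dots,f_{k-1}\in\mathbb{F}_q,$$ with the $k\times(n-k)$ matrix $(a_{ij})$ whose only nonzero entries are the $2\times 2$ block $(\eta_{ij})$ in its last two rows and first two columns. -/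

import Mathlib

open Polynomial

section Codes

variable {F : Type*} [Field F] {n k m : ℕ}

/-- The Euclidean dual `{x | x · c = 0 for all c ∈ C}` of a linear code `C ⊆ F ^ n`. -/
def dualCode (C : Submodule F (Fin n → F)) : Submodule F (Fin n → F) where
  carrier := {x | ∀ c ∈ C, ∑ i, x i * c i = 0}
  zero_mem' := by intro c _; simp
  add_mem' := by
    intro x y hx hy c hc
    simp only [Pi.add_apply, add_mul, Finset.sum_add_distrib, hx c hc, hy c hc, add_zero]
  smul_mem' := by
    intro a x hx c hc
    simp only [Pi.smul_apply, smul_eq_mul, mul_assoc, ← Finset.mul_sum, hx c hc, mul_zero]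

/-- A linear code is self-orthogonal if it is contained in its dual. -/
def IsSelfOrthogonal (C : Submodule F (Fin n → F)) : Prop := C ≤ dualCode C

open Classical in
/-- The minimum distance of a linear code: the least Hamming weight of a nonzero codeword
(the value is `0` for the zero code). -/
noncomputable def minDist (C : Submodule F (Fin n → F)) : ℕ :=
  sInf {w | ∃ c ∈ C, c ≠ 0 ∧ hammingNorm c = w}

/-- The evaluation map `f ↦ (v₁ f(α₁), …, vₙ f(αₙ))`. -/
def evalVec (α v : Fin n → F) (f : F[X]) : Fin n → F := fun i => v i * f.eval (α i)

/-- For a `k × m` matrix `A`, the set of all twisted polynomials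
`∑ i < k, fᵢ xⁱ + ∑ i < k, fᵢ ∑ j < m, A i j x ^ (k + j)`, with `i` and `j` counted from `0`. -/
def twistedPolys (A : Matrix (Fin k) (Fin m) F) : Set F[X] :=
  {P | ∃ f : Fin k → F,
    P = ∑ i, C (f i) * X ^ (i : ℕ) + ∑ i, C (f i) * ∑ j, C (A i j) * X ^ (k + (j : ℕ))}

/-- `D` is the twisted generalized Reed-Solomon code of length `n` with pairwise distinct
evaluation points `α`, nonzero column multipliers `v` and `k × (n - k)` twist matrix `A`. -/
structure IsTGRSCode (α v : Fin n → F) (A : Matrix (Fin k) (Fin (n - k)) F)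
    (D : Submodule F (Fin n → F)) : Prop where
  pos : 0 < k
  le : k ≤ n
  injective : Function.Injective α
  ne_zero : ∀ i, v i ≠ 0
  eq_image : (D : Set (Fin n → F)) = evalVec α v '' twistedPolys A

/-- The `k × m` matrix whose only possibly nonzero entries are those of the `2 × 2` block `η`
placed in the lower left corner (last two rows, first two columns). -/
def blockTwist (k m : ℕ) (η : Matrix (Fin 2) (Fin 2) F) : Matrix (Fin k) (Fin m) F :=
  fun i j => ∑ a : Fin 2, ∑ b : Fin 2,
    if (i : ℕ) + 2 = k + (a : ℕ) ∧ (j : ℕ) = (b : ℕ) then η a b else 0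

end Codes

/-!
Put `m = r p ^ s`, so that the code has length `2 m` and `m = 0` in `F`.

The derivative of `g = x ^ (2m) + b x ^ (2m - 1) + c` is `-b x ^ (2m - 2)`, whose only root `0` is not
a root of `g` because `c ≠ 0`. So `g` is separable and its `2m` roots `α i` are distinct and nonzero.
Moreover `v i ^ 2 = α i ^ (2 - 2m) = -b / g' (α i)`.

Every polynomial of the twisted family is `L + l W` with `deg L ≤ m - 2` and
`W = (b / 2) x ^ (m - 1) + x ^ m`. The choice of `b / 2` makes `W ^ 2` agree with `g` in degrees `2m`
and `2m - 1`, so that `(L + l W) (L' + l' W) - l l' g` has degree at most `2m - 2`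
(`exists_eval_mul_eq_eval`). Euler's identity `∑ R (α i) / g' (α i) = 0` for `deg R ≤ 2m - 2`
(`sum_eval_div_eval_derivative_nodal_eq_zero`) then gives self-orthogonality.

The dimension is that of any twisted code whose polynomials have degree less than its length
(`finrank_twistedCode`), and the distance bound counts roots of a polynomial of degree at most `m`
(`le_minDist_of_natDegree_le`).
-/

section TwistedCodes

variable {F : Type*} [Field F] {n k m : ℕ}

/-! ### The code of a twist matrix -/

/-- The linear map sending the coefficients `f` to the twisted polynomial they determine. -/
noncomputable def twistedPolyMap (A : Matrix (Fin k) (Fin m) F) : (Fin k → F) →ₗ[F] F[X] where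
  toFun f := ∑ i, C (f i) * X ^ (i : ℕ) + ∑ i, C (f i) * ∑ j, C (A i j) * X ^ (k + (j : ℕ))
  map_add' f g := by
    simp only [Pi.add_apply, C_add, add_mul, Finset.sum_add_distrib]
    ring
  map_smul' a f := by
    simp only [Pi.smul_apply, smul_eq_mul, C_mul, mul_assoc, ← Finset.mul_sum, ← mul_add,
      RingHom.id_apply, smul_eq_C_mul]

/-- `evalVec` as a linear map. -/
noncomputable def evalVecMap (α v : Fin n → F) : F[X] →ₗ[F] (Fin n → F) where
  toFun := evalVec α v
  map_add' f g := by
    ext i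
    simp [evalVec, mul_add]
  map_smul' a f := by
    ext i
    simp only [evalVec, eval_smul, Pi.smul_apply, smul_eq_mul, RingHom.id_apply]
    ring

/-- The code with evaluation points `α`, column multipliers `v` and twist matrix `A`. -/
noncomputable def twistedCode (α v : Fin n → F) (A : Matrix (Fin k) (Fin m) F) :
    Submodule F (Fin n → F) :=
  LinearMap.range (evalVecMap α v ∘ₗ twistedPolyMap A)

theorem coe_twistedCode (α v : Fin n → F) (A : Matrix (Fin k) (Fin m) F) :
    (twistedCode α v A : Set (Fin n → F)) = evalVec α v '' twistedPolys A := by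
  ext x
  constructor
  · rintro ⟨f, rfl⟩
    exact ⟨_, ⟨f, rfl⟩, rfl⟩
  · rintro ⟨_, ⟨f, rfl⟩, rfl⟩
    exact ⟨f, rfl⟩

theorem coeff_twistedPolyMap (A : Matrix (Fin k) (Fin m) F) (f : Fin k → F) (i : Fin k) :
    (twistedPolyMap A f).coeff i = f i := by
  have h1 : ∀ (j : Fin m), (i : ℕ) ≠ k + j := fun j => by have := i.2; omega
  simp [twistedPolyMap, finsetSum_coeff, coeff_X_pow, h1, Fin.val_inj]

theorem degree_twistedPolyMap_lt (A : Matrix (Fin k) (Fin m) F) (f : Fin k → F) :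
    (twistedPolyMap A f).degree < ((k + m : ℕ) : WithBot ℕ) := by
  rw [← mem_degreeLT]
  have hX : ∀ (d : ℕ) (a : F), d < k + m → C a * X ^ d ∈ degreeLT F (k + m) := fun d a hd =>
    mem_degreeLT.2 ((degree_C_mul_X_pow_le d a).trans_lt (by exact_mod_cast hd))
  refine add_mem (sum_mem fun i _ => hX _ _ (by omega)) (sum_mem fun i _ => ?_)
  rw [← smul_eq_C_mul]
  exact Submodule.smul_mem _ _ (sum_mem fun j _ => hX _ _ (by omega))

/-- Evaluation is injective on polynomials of degree less than the length. -/
theorem eq_zero_of_evalVec_eq_zero {α v : Fin n → F} (hα : Function.Injective α)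
    (hv : ∀ i, v i ≠ 0) {P : F[X]} (hP : P.degree < (n : WithBot ℕ)) (h : evalVec α v P = 0) :
    P = 0 := by
  refine Polynomial.eq_zero_of_degree_lt_of_eval_index_eq_zero (s := Finset.univ) (v := α)
    hα.injOn (by simpa using hP) fun i _ => ?_
  exact (mul_eq_zero.1 (congrFun h i)).resolve_left (hv i)

theorem finrank_twistedCode {α v : Fin n → F} (hα : Function.Injective α) (hv : ∀ i, v i ≠ 0)
    (hkm : k + m ≤ n) (A : Matrix (Fin k) (Fin m) F) :
    Module.finrank F (twistedCode α v A) = k := by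
  rw [twistedCode, LinearMap.finrank_range_of_inj, Module.finrank_fin_fun]
  rw [← LinearMap.ker_eq_bot, LinearMap.ker_eq_bot']
  intro f hf
  have h0 : twistedPolyMap A f = 0 :=
    eq_zero_of_evalVec_eq_zero hα hv
      ((degree_twistedPolyMap_lt A f).trans_le (by exact_mod_cast hkm)) hf
  ext i
  rw [← coeff_twistedPolyMap A f i, h0, coeff_zero, Pi.zero_apply]

/-- A nonzero polynomial of degree at most `d` vanishes at no more than `d` evaluation points. -/
theorem le_minDist_of_natDegree_le {α v : Fin n → F} (hα : Function.Injective α)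
    (hv : ∀ i, v i ≠ 0) {D : Submodule F (Fin n → F)} (hD : D ≠ ⊥) {d : ℕ}
    (h : ∀ x ∈ D, ∃ P : F[X], P.natDegree ≤ d ∧ evalVec α v P = x) :
    n - d ≤ minDist D := by
  classical
  unfold minDist
  obtain ⟨y, hy, hy0⟩ := (Submodule.ne_bot_iff D).1 hD
  refine le_csInf ⟨_, y, hy, hy0, rfl⟩ ?_
  rintro w ⟨x, hx, hx0, rfl⟩
  obtain ⟨P, hP, rfl⟩ := h x hx
  have hP0 : P ≠ 0 := by
    rintro rfl
    exact hx0 (by ext i; simp [evalVec])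
  have hz : (Finset.univ.filter fun i => evalVec α v P i = 0).card ≤ d := by
    rw [← Finset.card_image_of_injective _ hα]
    refine (Finset.card_le_card ?_).trans
      ((Multiset.toFinset_card_le P.roots).trans ((card_roots' P).trans hP))
    intro a ha
    obtain ⟨i, hi, rfl⟩ := Finset.mem_image.1 ha
    rw [Multiset.mem_toFinset, mem_roots hP0]
    exact (mul_eq_zero.1 (Finset.mem_filter.1 hi).2).resolve_left (hv i)
  have hsum := Finset.card_filter_add_card_filter_not (s := (Finset.univ : Finset (Fin n)))
    (fun i => evalVec α v P i = 0)
  rw [Finset.card_univ, Fintype.card_fin] at hsum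
  have : hammingNorm (evalVec α v P) =
      (Finset.univ.filter fun i => ¬ evalVec α v P i = 0).card := by
    unfold hammingNorm
    congr
  have h2 : n - d ≤ hammingNorm (evalVec α v P) := by omega
  -- `minDist` uses classical decidability of equality in its Hamming weight.
  convert h2

/-! ### Block twists -/

theorem sum_blockTwist_mul (hk : 2 ≤ k) (hm : 2 ≤ m) (η : Matrix (Fin 2) (Fin 2) F) (f : ℕ → F) :
    ∑ i : Fin k, C (f i) * ∑ j : Fin m, C (blockTwist k m η i j) * X ^ (k + (j : ℕ)) =
      ∑ a : Fin 2, C (f (k - 2 + (a : ℕ))) * ∑ b : Fin 2, C (η a b) * X ^ (k + (b : ℕ)) := by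
  have hi : ∀ (a : Fin 2), k - 2 + (a : ℕ) < k := fun a => by omega
  have hj : ∀ (b : Fin 2), (b : ℕ) < m := fun b => by omega
  have hA : ∀ (i : Fin k) (j : Fin m), blockTwist k m η i j =
      ∑ a : Fin 2, ∑ b : Fin 2,
        if i = ⟨_, hi a⟩ then (if j = ⟨_, hj b⟩ then η a b else 0) else 0 := by
    intro i j
    unfold blockTwist
    refine Finset.sum_congr rfl fun a _ => Finset.sum_congr rfl fun b _ => ?_
    rw [← ite_and]
    refine if_congr ?_ rfl rfl
    simp only [Fin.ext_iff]
    omega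
  simp_rw [hA, map_sum, Finset.mul_sum, Finset.sum_mul, Finset.mul_sum]
  rw [Finset.sum_congr rfl fun i _ => Finset.sum_comm, Finset.sum_comm]
  refine Finset.sum_congr rfl fun a _ => ?_
  rw [Finset.sum_congr rfl fun i _ => Finset.sum_comm, Finset.sum_comm]
  refine Finset.sum_congr rfl fun b _ => ?_
  rw [Finset.sum_eq_single ⟨_, hi a⟩ (fun i _ h => by simp [h]) (by simp),
    Finset.sum_eq_single ⟨_, hj b⟩ (fun j _ h => by simp [h]) (by simp)]
  simp

theorem twistedPolys_blockTwist (hk : 2 ≤ k) (hm : 2 ≤ m) (η : Matrix (Fin 2) (Fin 2) F) :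
    twistedPolys (blockTwist k m η) = {P | ∃ f : ℕ → F,
      P = ∑ i ∈ Finset.range k, C (f i) * X ^ i +
        ∑ a : Fin 2, C (f (k - 2 + (a : ℕ))) * ∑ b : Fin 2, C (η a b) * X ^ (k + (b : ℕ))} := by
  ext P
  constructor
  · rintro ⟨f, rfl⟩
    refine ⟨fun i => if h : i < k then f ⟨i, h⟩ else 0, ?_⟩
    have h := sum_blockTwist_mul hk hm η (fun i => if h : i < k then f ⟨i, h⟩ else 0)
    rw [← h, Finset.sum_range]
    simp
  · rintro ⟨f, rfl⟩
    refine ⟨fun i => f i, ?_⟩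
    have h := sum_blockTwist_mul hk hm η f
    rw [← h, Finset.sum_range]

/-! ### Euler's identity and the trinomial -/

/-- Euler's identity: the sum is the coefficient of `x ^ (#s - 1)` in `P`. -/
theorem sum_eval_div_eval_derivative_nodal_eq_zero {ι : Type*} [DecidableEq ι] {s : Finset ι}
    {α : ι → F} (hα : Set.InjOn α s) {P : F[X]} (hP : P.natDegree + 1 < s.card) :
    ∑ i ∈ s, P.eval (α i) / (derivative (Lagrange.nodal s α)).eval (α i) = 0 := by
  have h := Lagrange.coeff_eq_sum hα (P := P) (degree_le_natDegree.trans_lt (by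
    exact_mod_cast (by omega : P.natDegree < s.card)))
  rw [coeff_eq_zero_of_natDegree_lt (by omega)] at h
  rw [h]
  refine Finset.sum_congr rfl fun i hi => ?_
  rw [Lagrange.eval_nodal_derivative_eval_node_eq hi, Lagrange.eval_nodal]

theorem derivative_trinomial (hm : 0 < m) (hm0 : (m : F) = 0) (b c : F) :
    derivative (X ^ (2 * m) + C b * X ^ (2 * m - 1) + C c : F[X]) = -C b * X ^ (2 * m - 2) := by
  obtain ⟨l, rfl⟩ : ∃ l, m = l + 1 := ⟨m - 1, by omega⟩
  have e1 : 2 * (l + 1) - 1 = 2 * l + 1 := by omega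
  have e2 : 2 * (l + 1) - 2 = 2 * l := by omega
  have hl : (l : F) = -1 := by push_cast at hm0; linear_combination hm0
  rw [e1, e2, derivative_add, derivative_add]
  simp only [derivative_X_pow, derivative_C_mul, derivative_C, Nat.add_sub_cancel,
    Nat.cast_mul, Nat.cast_add, hl, Nat.cast_ofNat, Nat.cast_one, map_add, map_mul, map_neg]
  simp only [map_ofNat, map_one]
  ring

theorem separable_trinomial (hm : 1 < m) (hm0 : (m : F) = 0) {b c : F} (hb : b ≠ 0) (hc : c ≠ 0) :
    (X ^ (2 * m) + C b * X ^ (2 * m - 1) + C c : F[X]).Separable := by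
  rw [separable_def, derivative_trinomial (by omega) hm0]
  refine IsCoprime.mul_right ?_ (IsCoprime.pow_right ?_)
  · exact isCoprime_one_right.of_isCoprime_of_dvd_right
      (isUnit_iff_dvd_one.1 (isUnit_C.2 hb.isUnit).neg)
  · obtain ⟨l, rfl⟩ : ∃ l, m = l + 1 := ⟨m - 1, by omega⟩
    -- Bézout coefficients coming from `g - x (x ^ (2m - 1) + b x ^ (2m - 2)) = c`.
    refine ⟨C c⁻¹, -C c⁻¹ * (X ^ (2 * l + 1) + C b * X ^ (2 * l)), ?_⟩
    have e1 : 2 * (l + 1) - 1 = 2 * l + 1 := by omega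
    have hcc : (C c⁻¹ * C c : F[X]) = 1 := by rw [← C_mul, inv_mul_cancel₀ hc, C_1]
    rw [e1]
    linear_combination hcc

theorem natDegree_trinomial (hm : 0 < m) (b c : F) :
    (X ^ (2 * m) + C b * X ^ (2 * m - 1) + C c : F[X]).natDegree = 2 * m := by
  obtain ⟨l, rfl⟩ : ∃ l, m = l + 1 := ⟨m - 1, by omega⟩
  have e1 : 2 * (l + 1) - 1 = 2 * l + 1 := by omega
  rw [e1]
  compute_degree!
  simp [show 2 * (l + 1) ≠ 2 * l + 1 by omega]

theorem monic_trinomial (hm : 0 < m) (b c : F) :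
    (X ^ (2 * m) + C b * X ^ (2 * m - 1) + C c : F[X]).Monic := by
  have : 2 * m ≠ 0 := by omega
  have h2 : 2 * m - 1 ≠ 2 * m := by omega
  rw [Monic, leadingCoeff, natDegree_trinomial hm]
  simp [coeff_X_pow, coeff_C, this, h2.symm]

theorem eq_nodal_of_monic {ι : Type*} {s : Finset ι} {α : ι → F} (hα : Set.InjOn α s)
    {P : F[X]} (hP : P.Monic) (hdeg : P.natDegree = s.card) (h : ∀ i ∈ s, P.eval (α i) = 0) :
    P = Lagrange.nodal s α := by
  refine Polynomial.eq_of_degree_sub_lt_of_eval_index_eq s hα ?_ fun i hi => ?_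
  · have hd : P.degree = (Lagrange.nodal s α).degree := by
      rw [Lagrange.degree_nodal, degree_eq_natDegree hP.ne_zero, hdeg]
    have := degree_sub_lt_left hd hP.ne_zero (by rw [hP.leadingCoeff, Lagrange.nodal_monic.leadingCoeff])
    rwa [degree_eq_natDegree hP.ne_zero, hdeg] at this
  · rw [h i hi, Lagrange.eval_nodal_at_node hi]

/-- On the roots of the trinomial, the product of two polynomials `L + l W` with
`W = β x ^ (m - 1) + x ^ m` takes the values of a polynomial of degree at most `2m - 2`. -/
theorem exists_eval_mul_eq_eval (hm : 2 ≤ m) {β c l₁ l₂ : F} {L₁ L₂ : F[X]}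
    (h₁ : L₁.natDegree ≤ m - 2) (h₂ : L₂.natDegree ≤ m - 2) :
    ∃ R : F[X], R.natDegree ≤ 2 * m - 2 ∧
      ∀ x : F, (X ^ (2 * m) + C (2 * β) * X ^ (2 * m - 1) + C c : F[X]).eval x = 0 →
        (L₁ + C l₁ * (C β * X ^ (m - 1) + X ^ m)).eval x *
          (L₂ + C l₂ * (C β * X ^ (m - 1) + X ^ m)).eval x = R.eval x := by
  obtain ⟨d, rfl⟩ : ∃ d, m = d + 2 := ⟨m - 2, by omega⟩
  have e1 : d + 2 - 1 = d + 1 := by omega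
  have e2 : d + 2 - 2 = d := by omega
  have e3 : 2 * (d + 2) - 1 = 2 * d + 3 := by omega
  have e4 : 2 * (d + 2) - 2 = 2 * d + 2 := by omega
  rw [e2] at h₁ h₂
  rw [e1, e3, e4]
  have hW : (C β * X ^ (d + 1) + X ^ (d + 2) : F[X]).natDegree ≤ d + 2 := by
    compute_degree
  refine ⟨L₁ * L₂ + C l₂ * (L₁ * (C β * X ^ (d + 1) + X ^ (d + 2))) +
    C l₁ * (L₂ * (C β * X ^ (d + 1) + X ^ (d + 2))) +
    C (l₁ * l₂) * (C (β ^ 2) * X ^ (2 * d + 2) - C c), ?_, ?_⟩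
  · refine natDegree_add_le_of_degree_le (natDegree_add_le_of_degree_le
      (natDegree_add_le_of_degree_le ?_ ?_) ?_) ?_
    · exact (natDegree_mul_le_of_le h₁ h₂).trans (by omega)
    · exact (natDegree_C_mul_le _ _).trans ((natDegree_mul_le_of_le h₁ hW).trans (by omega))
    · exact (natDegree_C_mul_le _ _).trans ((natDegree_mul_le_of_le h₂ hW).trans (by omega))
    · refine (natDegree_C_mul_le _ _).trans ?_
      compute_degree
  · intro x hx
    simp only [eval_add, eval_mul, eval_sub, eval_C, eval_pow, eval_X] at hx ⊢
    linear_combination l₁ * l₂ * hx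

end TwistedCodes

/-! ### Self-orthogonality over the roots of the trinomial -/

section Trinomial

variable {F : Type*} [Field F] {n m : ℕ}

/-- By `hη` both rows of the block contribute multiples of the same polynomial
`β x ^ (m - 1) + x ^ m`. -/
theorem exists_eq_add_of_mem_twistedPolys_blockTwist {k : ℕ} (hm : 3 ≤ m) (hk : 2 ≤ k)
    {η : Matrix (Fin 2) (Fin 2) F} {β : F} (hη : ∀ i, η i 0 = β * η i 1) {P : F[X]}
    (hP : P ∈ twistedPolys (blockTwist (m - 1) k η)) :
    ∃ (L : F[X]) (l : F), L.natDegree ≤ m - 2 ∧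
      P = L + C l * (C β * X ^ (m - 1) + X ^ m) := by
  rw [twistedPolys_blockTwist (by omega) hk] at hP
  obtain ⟨f, rfl⟩ := hP
  refine ⟨∑ i ∈ Finset.range (m - 1), C (f i) * X ^ i, ∑ a : Fin 2, f (m - 1 - 2 + (a : ℕ)) * η a 1,
    natDegree_sum_le_of_forall_le (n := m - 2) _ _ fun i hi => ?_, ?_⟩
  · have := Finset.mem_range.1 hi
    exact (natDegree_C_mul_X_pow_le _ _).trans (by omega)
  · have e : m - 1 + 1 = m := by omega
    simp only [Fin.sum_univ_two, hη, Fin.val_zero, Fin.val_one, C_mul, C_add, e, add_zero]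
    ring

/-- The codeword products are `-2β R (α i) / g' (α i)` with `g` the trinomial and `deg R ≤ 2m - 2`,
so they sum to zero by Euler's identity. -/
theorem isSelfOrthogonal_of_trinomial (hm : 2 ≤ m) (hn : n = 2 * m) (hm0 : (m : F) = 0)
    {β c : F} (hβ : 2 * β ≠ 0) {α v : Fin n → F} (hα : Function.Injective α)
    (hroot : ∀ i, (X ^ (2 * m) + C (2 * β) * X ^ (2 * m - 1) + C c : F[X]).eval (α i) = 0)
    (hα0 : ∀ i, α i ≠ 0) (hv : ∀ i, v i * α i ^ (m - 1) = 1) {D : Submodule F (Fin n → F)}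
    (hD : ∀ x ∈ D, ∃ (L : F[X]) (l : F), L.natDegree ≤ m - 2 ∧
      evalVec α v (L + C l * (C β * X ^ (m - 1) + X ^ m)) = x) :
    IsSelfOrthogonal D := by
  intro x hx y hy
  obtain ⟨L₁, l₁, h₁, rfl⟩ := hD x hx
  obtain ⟨L₂, l₂, h₂, rfl⟩ := hD y hy
  obtain ⟨R, hR, hRe⟩ := exists_eval_mul_eq_eval (β := β) (c := c) (l₁ := l₁) (l₂ := l₂) hm h₁ h₂
  have hsum := sum_eval_div_eval_derivative_nodal_eq_zero (s := Finset.univ) hα.injOn (P := R)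
    (by rw [Finset.card_univ, Fintype.card_fin]; omega)
  rw [← eq_nodal_of_monic hα.injOn (monic_trinomial (by omega) (2 * β) c)
    (by rw [natDegree_trinomial (by omega), Finset.card_univ, Fintype.card_fin, hn])
    (fun i _ => hroot i), derivative_trinomial (by omega) hm0] at hsum
  rw [← mul_zero (-(2 * β)), ← hsum, Finset.mul_sum]
  refine Finset.sum_congr rfl fun i _ => ?_
  have e : 2 * m - 2 = (m - 1) * 2 := by omega
  have hpow : α i ^ (m - 1) ≠ 0 := pow_ne_zero _ (hα0 i)
  have hvi : v i = (α i ^ (m - 1))⁻¹ := eq_inv_of_mul_eq_one_left (hv i)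
  unfold evalVec
  rw [mul_mul_mul_comm, hRe _ (hroot i), hvi, e, pow_mul]
  simp only [eval_mul, eval_neg, eval_C, eval_pow, eval_X]
  have hβ' : -(2 * β) ≠ 0 := neg_ne_zero.2 hβ
  rw [← mul_div_assoc, mul_div_mul_left _ _ hβ']
  field_simp

end Trinomial

theorem natCast_eq_zero_of_natCard_eq_pow {F : Type*} [Field F] {p h : ℕ} (hp : 1 < p)
    (hh : 0 < h) (hF : Nat.card F = p ^ h) : (p : F) = 0 := by
  have : Finite F := Nat.finite_of_card_ne_zero (by rw [hF]; positivity)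
  have : Fintype F := Fintype.ofFinite F
  have h0 : ((Fintype.card F : ℕ) : F) = 0 := FiniteField.cast_card_eq_zero F
  rw [← Nat.card_eq_fintype_card, hF, Nat.cast_pow] at h0
  exact pow_eq_zero_iff (by omega) |>.1 h0

theorem mainTheorem9 {K F : Type*} [Field K] [Field F] [Algebra K F]
    (p s h t r : ℕ) (hp : p.Prime) (hp_odd : Odd p)
    (hs : 0 < s) (hh : 0 < h) (ht : 0 < t) (hr : 0 < r)
    (hth : t ∣ h) (hsh : s ≤ h) (hrp : Nat.gcd r p = 1)
    (hK : Nat.card K = p ^ t) (hF : Nat.card F = p ^ h)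
    (b c : K) (hb : b ≠ 0) (hc : c ≠ 0) (g : K[X])
    (hg : g = X ^ (2 * r * p ^ s) + C b * X ^ (2 * r * p ^ s - 1) + C c)
    (hsplit : g.IsSplittingField K F)
    (α : Fin (2 * r * p ^ s) → F) (hα : Set.range α = g.rootSet F)
    (v : Fin (2 * r * p ^ s) → F)
    (hv : ∀ i, v i = α i ^ (1 - (r : ℤ) * (p : ℤ) ^ s))
    (η : Matrix (Fin 2) (Fin 2) F)
    (hη : ∀ i, η i 1 ≠ 0 ∧ η i 0 = algebraMap K F b / 2 * η i 1)
    (S₁ : Set F[X])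
    (hS₁ : S₁ = {P | ∃ f : ℕ → F,
      P = ∑ i ∈ Finset.range (r * p ^ s - 1), C (f i) * X ^ i
        + ∑ i : Fin 2, C (f (r * p ^ s - 3 + (i : ℕ))) * C (η i 1) *
            (C (algebraMap K F b / 2) * X ^ (r * p ^ s - 1) + X ^ (r * p ^ s))}) :
    ∃ C₁ : Submodule F (Fin (2 * r * p ^ s) → F),
      (C₁ : Set (Fin (2 * r * p ^ s) → F)) = evalVec α v '' S₁ ∧
      Module.finrank F C₁ = r * p ^ s - 1 ∧
      r * p ^ s ≤ minDist C₁ ∧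
      IsSelfOrthogonal C₁ ∧
      IsTGRSCode α v
        (blockTwist (r * p ^ s - 1) (2 * r * p ^ s - (r * p ^ s - 1)) η) C₁ := by

  obtain ⟨m, hmdef⟩ : ∃ m, m = r * p ^ s := ⟨_, rfl⟩
  have hp2 : p ≠ 2 := by rintro rfl; exact absurd hp_odd (by decide)
  have hm : 3 ≤ m := by
    have h3 : 3 ≤ p := by have := hp.two_le; omega
    have h1 : p ≤ p ^ s := Nat.le_self_pow hs.ne' p
    have h2 : p ^ s ≤ r * p ^ s := Nat.le_mul_of_pos_left _ hr
    omega
  have hn : 2 * r * p ^ s = 2 * m := by rw [hmdef, mul_assoc]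
  have hp0 : (p : F) = 0 := natCast_eq_zero_of_natCard_eq_pow hp.one_lt hh hF
  have hm0 : (m : F) = 0 := by
    rw [hmdef, Nat.cast_mul, Nat.cast_pow, hp0, zero_pow hs.ne', mul_zero]
  have h2 : (2 : F) ≠ 0 := by
    intro h20
    obtain ⟨a, ha⟩ := hp_odd
    rw [ha] at hp0
    push_cast at hp0
    rw [h20, zero_mul, zero_add] at hp0
    exact one_ne_zero hp0
  obtain ⟨β, hβ⟩ : ∃ β, β = algebraMap K F b / 2 := ⟨_, rfl⟩
  obtain ⟨γ, hγ⟩ : ∃ γ, γ = algebraMap K F c := ⟨_, rfl⟩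
  have hbβ : algebraMap K F b = 2 * β := by rw [hβ, mul_div_cancel₀ _ h2]
  have hβ0 : 2 * β ≠ 0 := by
    rw [← hbβ]
    exact (_root_.map_ne_zero _).2 hb
  have hγ0 : γ ≠ 0 := by
    rw [hγ]
    exact (_root_.map_ne_zero _).2 hc
  have hgF : g.map (algebraMap K F) = X ^ (2 * m) + C (2 * β) * X ^ (2 * m - 1) + C γ := by
    rw [hg, hn, ← hbβ, hγ]
    simp
  have hroot : ∀ i, (X ^ (2 * m) + C (2 * β) * X ^ (2 * m - 1) + C γ : F[X]).eval (α i) = 0 := by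
    intro i
    have hi : α i ∈ g.rootSet F := hα ▸ Set.mem_range_self i
    rw [← hgF, eval_map_algebraMap]
    exact (mem_rootSet.1 hi).2
  -- The `2m` values `α i` exhaust the `2m` distinct roots of a separable split polynomial.
  have hinj : Function.Injective α := by
    classical
    have hsep : g.Separable := by
      rw [← separable_map (algebraMap K F), hgF]
      exact separable_trinomial (by omega) hm0 hβ0 hγ0
    have hcard := card_rootSet_eq_natDegree hsep hsplit.splits'
    rw [← natDegree_map (algebraMap K F), hgF, natDegree_trinomial (by omega)] at hcard
    have hsurj : Function.Surjective (Set.rangeFactorization α) := Set.rangeFactorization_surjective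
    have hbij := (Fintype.bijective_iff_surjective_and_card (Set.rangeFactorization α)).2
      ⟨hsurj, by
        rw [Fintype.card_fin]
        refine hn.trans (hcard.symm.trans ?_)
        exact Fintype.card_congr (Equiv.setCongr hα.symm)⟩
    exact Set.rangeFactorization_injective.1 hbij.1
  have hα0 : ∀ i, α i ≠ 0 := by
    intro i hi
    have h := hroot i
    rw [hi] at h
    have e1 : 2 * m ≠ 0 := by omega
    have e2 : 2 * m - 1 ≠ 0 := by omega
    simp only [eval_add, eval_mul, eval_pow, eval_X, eval_C, zero_pow e1, zero_pow e2, mul_zero,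
      zero_add] at h
    exact hγ0 h
  have hvα : ∀ i, v i * α i ^ (m - 1) = 1 := by
    intro i
    have e : (1 - (r : ℤ) * (p : ℤ) ^ s) = -((m - 1 : ℕ) : ℤ) := by
      rw [Nat.cast_sub (by omega), hmdef]
      push_cast
      ring
    rw [hv, e, zpow_neg, zpow_natCast, inv_mul_cancel₀ (pow_ne_zero _ (hα0 i))]
  have hv0 : ∀ i, v i ≠ 0 := fun i hi => by simpa [hi] using hvα i
  rw [← hβ] at hS₁
  simp only [← hβ] at hη
  rw [← hmdef] at hS₁ ⊢
  have hk : 2 ≤ 2 * r * p ^ s - (m - 1) := by omega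
  have hS : S₁ = twistedPolys (blockTwist (m - 1) (2 * r * p ^ s - (m - 1)) η) := by
    rw [hS₁, twistedPolys_blockTwist (by omega) hk]
    have e1 : m - 1 - 2 = m - 3 := by omega
    have e2 : m - 1 + 1 = m := by omega
    ext P
    refine exists_congr fun f => ?_
    simp only [Fin.sum_univ_two, Fin.val_zero, Fin.val_one, (hη _).2, e1, e2, add_zero, C_mul,
      mul_add, mul_assoc, mul_left_comm (C (η _ 1)) (C β)]
  have hfin := finrank_twistedCode hinj hv0 (by omega)
    (blockTwist (m - 1) (2 * r * p ^ s - (m - 1)) η)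
  have hmem : ∀ x ∈ twistedCode α v (blockTwist (m - 1) (2 * r * p ^ s - (m - 1)) η),
      ∃ (L : F[X]) (l : F), L.natDegree ≤ m - 2 ∧
        evalVec α v (L + C l * (C β * X ^ (m - 1) + X ^ m)) = x := by
    intro x hx
    rw [← SetLike.mem_coe, coe_twistedCode] at hx
    obtain ⟨P, hP, rfl⟩ := hx
    obtain ⟨L, l, hL, rfl⟩ :=
      exists_eq_add_of_mem_twistedPolys_blockTwist hm hk (fun i => (hη i).2) hP
    exact ⟨L, l, hL, rfl⟩
  refine ⟨twistedCode α v (blockTwist (m - 1) (2 * r * p ^ s - (m - 1)) η), ?_, hfin, ?_, ?_, ?_⟩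
  · rw [coe_twistedCode, hS]
  · have hne : twistedCode α v (blockTwist (m - 1) (2 * r * p ^ s - (m - 1)) η) ≠ ⊥ := by
      intro h
      rw [h, finrank_bot] at hfin
      omega
    refine le_trans (by omega) (le_minDist_of_natDegree_le (d := m) hinj hv0 hne fun x hx => ?_)
    obtain ⟨L, l, hL, rfl⟩ := hmem x hx
    refine ⟨_, natDegree_add_le_of_degree_le (hL.trans (by omega))
      ((natDegree_C_mul_le _ _).trans ?_), rfl⟩
    compute_degree
  · exact isSelfOrthogonal_of_trinomial (by omega) hn hm0 hβ0 hinj hroot hα0 hvα hmem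
  · exact ⟨by omega, by omega, hinj, hv0, coe_twistedCode _ _ _⟩
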